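/- Let $\beta>1$ be a real number. For $y\in\mathbb R$ let $\lceil y\rceil$ be the smallest integer $\ge y$, and let $T_\beta:(0,1]\to(0,1]$ be given by $T_\beta x=\beta x-\lceil\beta x\rceil+1$. The $\beta$-expansion of $x\in(0,1]$ is the digit sequence $(\varepsilon_n(x,\beta))_{n\ge1}$ with $\varepsilon_n(x,\beta)=\lceil\beta T_\beta^{n-1}x\rceil-1$, and the $\beta$-expansion of $0$ is $(0,0,0,\ldots)$. For $x\in[0,1]$ and $n\ge1$ let $$r_n(x,\beta)=\max\{j\ge1:\ \varepsilon_{i+1}(x,\beta)=\cdots=\varepsilon_{i+j}(x,\beta)=0\ \text{for some}\ 0\le i\le n-j\},$$ with $r_n(x,\beta)=0$ if there is no such $j$; this is the maximal length of a run of zeros among the first $n$ digits of $x$. Let $\varphi:\mathbb N\to\mathbb R^+$ (with $\mathbb N=\{1,2,\ldots\}$ and $\mathbb R^+=(0,\infty)$) be a function with $\lim_{n\to\infty}\varphi(n)=+\infty$, and let $$E_{\max}^{\varphi}=\Big\{x\in[0,1]:\ \liminf_{n\to\infty}\frac{r_n(x,\beta)}{\varphi(n)}=0,\ \limsup_{n\to\infty}\frac{r_n(x,\beta)}{\varphi(n)}=+\infty\Big\}.$$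 1. If $\limsup_{n\to\infty}\frac{n}{\varphi(n)}<+\infty$, then $E_{\max}^{\varphi}=\emptyset$. 2. If $\limsup_{n\to\infty}\frac{n}{\varphi(n)}=+\infty$, then $E_{\max}^{\varphi}$ has Hausdorff dimension $1$. -/

import Mathlib

open Filter

noncomputable section

namespace BetaExpansion

/-- The `β`-transformation `T_β x = β x - ⌈β x⌉ + 1`; it maps `(0, 1]` into `(0, 1]`. -/
def betaT (β x : ℝ) : ℝ := β * x - (⌈β * x⌉ : ℝ) + 1

/-- The `n`-th digit (`n ≥ 1`) of the `β`-expansion of `x`: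
`ε_n(x, β) = ⌈β T_β^{n-1} x⌉ - 1` for `x ∈ (0, 1]`, and all digits of `0` are `0`.
The value at the index `n = 0` has no meaning and is never used. -/
def digit (β x : ℝ) (n : ℕ) : ℤ :=
  if x = 0 then 0 else ⌈β * (betaT β)^[n - 1] x⌉ - 1

/-- The lengths `j ≥ 1` of the blocks of consecutive zeros among the first `n` digits of `x`. -/
def zeroRuns (β x : ℝ) (n : ℕ) : Set ℕ :=
  {j | 1 ≤ j ∧ ∃ i : ℕ, i + j ≤ n ∧ ∀ k : ℕ, 1 ≤ k → k ≤ j → digit β x (i + k) = 0}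

/-- The run-length function `r_n(x, β)`: the largest length of a block of consecutive zeros among
the first `n` digits of `x`, and `0` if there is no such block (the supremum in `ℕ` of the empty
set is `0`; the set is bounded by `n`). -/
def runLength (β x : ℝ) (n : ℕ) : ℕ := sSup (zeroRuns β x n)

/-- The set of `x ∈ [0, 1]` with `liminf r_n(x, β) / φ(n) = 0` and
`limsup r_n(x, β) / φ(n) = +∞`; the limits are taken in the extended reals. -/
def exceptionalSet (β : ℝ) (φ : ℕ → ℝ) : Set ℝ :=
  {x | x ∈ Set.Icc (0 : ℝ) 1 ∧
    liminf (fun n : ℕ => (((runLength β x n : ℝ) / φ n : ℝ) : EReal)) atTop = 0 ∧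
    limsup (fun n : ℕ => (((runLength β x n : ℝ) / φ n : ℝ) : EReal)) atTop = ⊤}

end BetaExpansion

end

noncomputable section

namespace BetaExpansion

/-! Since `r_n ≤ n`, a finite limsup of `n / φ n` bounds `r_n / φ n` as well, so the first claim is
immediate. For the second, given `s < 1`, a subset of the exceptional set of dimension at least `s`
is built from blocks of `N` digits.

A block is a full cylinder: `T_β^N` maps it onto all of `(0, 1]`, so such blocks can be concatenated
freely. By `pow_le_card_fullBase` there are at least `β^N / (N + 1)` of them, so for any `t < 1` and
suitable `N` there remain at least `β^(N t)` usable nonzero letters (`exists_letters`).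

Zero blocks are forced on the intervals `[p k, p k + p k / D)`, with `p` growing very fast, and
arbitrary letters are put elsewhere. A nonzero block interrupts every zero run, so the runs before
block `p (k + 1)` have length `O(N * p k)`, negligible against `φ (N * p (k + 1))`. The forced run
has length about `N * p k / D`, and `p k` is chosen so that some `n` of order `N * p k` has `φ n`
negligible against `n`. This yields liminf `0` and limsup `⊤` (`blockSum_mem_exceptionalSet`).

Forced blocks have density at most `2 / D`, so reading the letters as base-`M` digits is an
`s`-Hölder map onto `[0, 1]` (`ofDigits_holder`), and `le_dimH_range` gives dimension at least `s`.
-/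

/-! ### The β-transformation and full cylinders -/

theorem betaT_of_mem {β x : ℝ} {d : ℤ} (h1 : (d : ℝ) < β * x) (h2 : β * x ≤ d + 1) :
    betaT β x = β * x - d := by
  have : ⌈β * x⌉ = d + 1 := by
    rw [Int.ceil_eq_iff]; push_cast; constructor <;> linarith
  rw [betaT, this]; push_cast; ring

theorem betaT_mem (β x : ℝ) : betaT β x ∈ Set.Ioc (0 : ℝ) 1 := by
  have h1 := Int.le_ceil (β * x)
  have h2 := Int.ceil_lt_add_one (β * x)
  constructor <;> rw [betaT] <;> linarith

theorem betaT_iterate_mem (β : ℝ) {x : ℝ} (hx : x ∈ Set.Ioc (0 : ℝ) 1) (n : ℕ) :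
    (betaT β)^[n] x ∈ Set.Ioc (0 : ℝ) 1 := by
  cases n with
  | zero => exact hx
  | succ n => rw [Function.iterate_succ_apply']; exact betaT_mem _ _

theorem betaT_div {β y : ℝ} (hβ : 1 < β) (hy : y ∈ Set.Ioc (0 : ℝ) 1) : betaT β (y / β) = y := by
  have h : β * (y / β) = y := by field_simp
  rw [betaT_of_mem (d := 0)] <;> simp [h, hy.1, hy.2]

/-- Left endpoints of the full cylinders of order `n`: the intervals `(a, a + β⁻ⁿ]` which `T_β^n`
maps affinely onto `(0, 1]`. -/
def fullBase (β : ℝ) (n : ℕ) : Set ℝ :=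
  {a | 0 ≤ a ∧ ∀ y ∈ Set.Ioc (0 : ℝ) 1, a + y / β ^ n ≤ 1 ∧ (betaT β)^[n] (a + y / β ^ n) = y}

theorem zero_mem_fullBase {β : ℝ} (hβ : 1 < β) (n : ℕ) : 0 ∈ fullBase β n := by
  refine ⟨le_rfl, fun y hy => ?_⟩
  have hpos : 0 < β ^ n := by positivity
  refine ⟨?_, ?_⟩
  · rw [zero_add, div_le_one hpos]
    exact hy.2.trans (one_le_pow₀ hβ.le)
  · rw [zero_add]
    induction n with
    | zero => simp
    | succ n ih =>
      have h1 : 1 ≤ β ^ n := one_le_pow₀ hβ.le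
      have h2 : y / β ^ n ∈ Set.Ioc (0 : ℝ) 1 :=
        ⟨by have := hy.1; positivity, (div_le_one (by positivity)).2 (hy.2.trans h1)⟩
      rw [Function.iterate_succ_apply, pow_succ, ← div_div, betaT_div hβ h2]
      exact ih (by positivity)

/-- If the cylinders overlapped, `a + β⁻ⁿ` would lie in both; the iterate there is `1` seen from `a`
but less than `1` seen from `a'`. -/
theorem fullBase_separated {β : ℝ} (hβ : 1 < β) {n : ℕ} {a a' : ℝ} (ha : a ∈ fullBase β n)
    (ha' : a' ∈ fullBase β n) (h : a < a') : a + (β ^ n)⁻¹ ≤ a' := by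
  by_contra! hlt
  have hpos : 0 < β ^ n := by positivity
  have h1 := (ha.2 1 (by simp)).2
  have hy : 1 - β ^ n * (a' - a) ∈ Set.Ioc (0 : ℝ) 1 := by
    constructor
    · have : β ^ n * (a' - a) < β ^ n * (β ^ n)⁻¹ := by gcongr; linarith
      rw [mul_inv_cancel₀ hpos.ne'] at this
      linarith
    · nlinarith
  have h2 := (ha'.2 _ hy).2
  have h3 : a' + (1 - β ^ n * (a' - a)) / β ^ n = a + 1 / β ^ n := by field_simp; ring
  rw [h3, h1] at h2
  nlinarith

theorem fullBase_finite {β : ℝ} (hβ : 1 < β) (n : ℕ) : (fullBase β n).Finite := by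
  have hpos : 0 < β ^ n := by positivity
  refine Set.Finite.of_finite_image (f := fun a => ⌊a * β ^ n⌋) ?_ ?_
  · refine (Set.finite_Icc (0 : ℤ) ⌊β ^ n⌋).subset ?_
    rintro _ ⟨a, ha, rfl⟩
    have h1 := (ha.2 1 (by simp)).1
    have h0 := ha.1
    refine ⟨Int.floor_nonneg.2 (by positivity), Int.floor_le_floor ?_⟩
    have : a ≤ 1 := by
      have : 0 < 1 / β ^ n := by positivity
      linarith
    nlinarith
  · have key : ∀ a ∈ fullBase β n, ∀ b ∈ fullBase β n, a < b →
        ⌊a * β ^ n⌋ ≠ ⌊b * β ^ n⌋ := by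
      intro a ha b hb h
      have h1 := fullBase_separated hβ ha hb h
      have h2 : a * β ^ n + 1 ≤ b * β ^ n := by
        have := mul_le_mul_of_nonneg_right h1 hpos.le
        rwa [add_mul, inv_mul_cancel₀ hpos.ne'] at this
      have h3 := Int.floor_le_floor h2
      rw [Int.floor_add_one] at h3
      omega
    intro a ha b hb hab
    rcases lt_trichotomy a b with h | h | h
    · exact absurd hab (key a ha b hb h)
    · exact h
    · exact absurd hab.symm (key b hb a ha h)

/-- This is appending a zero digit: `T_β` maps `(0, 1/β]` onto `(0, 1]`. -/
theorem fullBase_subset_succ {β : ℝ} (hβ : 1 < β) (n : ℕ) :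
    fullBase β n ⊆ fullBase β (n + 1) := by
  intro a ha
  refine ⟨ha.1, fun y hy => ?_⟩
  have hy' : y / β ∈ Set.Ioc (0 : ℝ) 1 :=
    ⟨by have := hy.1; positivity, (div_le_one (by positivity)).2 (hy.2.trans hβ.le)⟩
  have h := ha.2 _ hy'
  have e : y / β ^ (n + 1) = y / β / β ^ n := by field_simp; ring
  rw [e]
  refine ⟨h.1, ?_⟩
  rw [Function.iterate_succ_apply', h.2, betaT_div hβ hy]

theorem fullBase_mono {β : ℝ} (hβ : 1 < β) : Monotone (fullBase β) :=
  monotone_nat_of_le_succ (fullBase_subset_succ hβ)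

theorem div_mem_fullBase_succ {β : ℝ} (hβ : 1 < β) {n : ℕ} {a : ℝ} (ha : a ∈ fullBase β n) :
    a / β ∈ fullBase β (n + 1) := by
  have h0 := ha.1
  refine ⟨by positivity, fun y hy => ?_⟩
  have h := ha.2 y hy
  have hm : a + y / β ^ n ∈ Set.Ioc (0 : ℝ) 1 :=
    ⟨by have := hy.1; positivity, h.1⟩
  have e : a / β + y / β ^ (n + 1) = (a + y / β ^ n) / β := by field_simp; ring
  rw [e]
  refine ⟨(div_le_one (by positivity)).2 (hm.2.trans hβ.le), ?_⟩
  rw [Function.iterate_succ_apply, betaT_div hβ hm, h.2]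

/-! ### Counting full cylinders -/

/-- Near `1`, the iterate `T_β^k` is affine with slope `β^k`. -/
theorem iterate_near_one {β : ℝ} (hβ : 1 < β) (k : ℕ) :
    (betaT β)^[k] 1 / β ^ k ≤ 1 ∧
    ∀ y ∈ Set.Ioc (1 - (betaT β)^[k] 1 / β ^ k) 1,
      (betaT β)^[k] y = (betaT β)^[k] 1 + β ^ k * (y - 1) := by
  induction k with
  | zero => simp
  | succ k ih =>
    obtain ⟨ih1, ih2⟩ := ih
    have hpos : 0 < β ^ k := by positivity
    set t := (betaT β)^[k] 1 with ht
    have htm : t ∈ Set.Ioc (0 : ℝ) 1 := betaT_iterate_mem β (by simp) k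
    set c : ℤ := ⌈β * t⌉ - 1 with hc
    have hc1 : (c : ℝ) < β * t := by
      have := Int.ceil_lt_add_one (β * t)
      rw [hc]; push_cast; linarith
    have hc2 : β * t ≤ c + 1 := by
      have := Int.le_ceil (β * t)
      rw [hc]; push_cast; linarith
    have hc0 : (0 : ℝ) ≤ c := by
      have : 0 < ⌈β * t⌉ := Int.ceil_pos.2 (by have := htm.1; positivity)
      have : 0 ≤ c := by omega
      exact_mod_cast this
    have hT : (betaT β)^[k + 1] 1 = β * t - c := by
      rw [Function.iterate_succ_apply', ← ht, betaT_of_mem hc1 hc2]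
    have e : (β * t - c) / β ^ (k + 1) = t / β ^ k - c / β ^ (k + 1) := by
      field_simp; ring
    have hcd : 0 ≤ (c : ℝ) / β ^ (k + 1) := by positivity
    rw [hT, e]
    refine ⟨by linarith, fun y hy => ?_⟩
    have hy1 := ih2 y ⟨by linarith [hy.1], hy.2⟩
    rw [Function.iterate_succ_apply', hy1]
    have h1 : (c : ℝ) < β * (t + β ^ k * (y - 1)) := by
      have h3 := mul_lt_mul_of_pos_left hy.1 (show 0 < β ^ (k + 1) by positivity)
      have h4 : β ^ (k + 1) * (1 - (t / β ^ k - c / β ^ (k + 1))) = β ^ (k + 1) - β * t + c := by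
        field_simp
        ring
      rw [h4, pow_succ] at h3
      nlinarith
    have h2 : β * (t + β ^ k * (y - 1)) ≤ c + 1 := by
      refine le_trans ?_ hc2
      have : β ^ k * (y - 1) ≤ 0 := mul_nonpos_of_nonneg_of_nonpos hpos.le (by linarith [hy.2])
      gcongr
      linarith
    rw [betaT_of_mem h1 h2]
    ring

/-- Every point lies in a full cylinder of order `m`, at a relative position from which it follows
the expansion of `1` for the remaining `k` steps. -/
theorem exists_fullBase_decomposition {β : ℝ} (hβ : 1 < β) {x : ℝ} (hx : x ∈ Set.Ioc (0 : ℝ) 1)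
    (n : ℕ) : ∃ m k : ℕ, m + k = n ∧ ∃ a ∈ fullBase β m,
      ∃ y ∈ Set.Ioc (1 - (betaT β)^[k] 1 / β ^ k) 1, x = a + y / β ^ m := by
  induction n with
  | zero =>
    exact ⟨0, 0, rfl, 0, zero_mem_fullBase hβ 0, x, by simpa using hx, by simp⟩
  | succ n ih =>
    obtain ⟨m, k, hmk, a, ha, y, hy, hxy⟩ := ih
    obtain ⟨hk1, hk2⟩ := iterate_near_one hβ k
    have hpk : 0 < β ^ k := by positivity
    have hpm : 0 < β ^ m := by positivity
    set t := (betaT β)^[k] 1 with ht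
    have htm : t ∈ Set.Ioc (0 : ℝ) 1 := betaT_iterate_mem β (by simp) k
    have hy0 : 0 < y := by linarith [hy.1]
    have hyT := hk2 y hy
    set v := (betaT β)^[k] y with hv
    have hvm : v ∈ Set.Ioc (0 : ℝ) 1 := betaT_iterate_mem β ⟨hy0, hy.2⟩ k
    have hvt : v ≤ t := by
      have : β ^ k * (y - 1) ≤ 0 := mul_nonpos_of_nonneg_of_nonpos hpk.le (by linarith [hy.2])
      linarith
    have hyv : y = 1 - t / β ^ k + v / β ^ k := by
      rw [hyT]; field_simp; ring
    set d : ℤ := ⌈β * v⌉ - 1 with hd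
    have hd1 : (d : ℝ) < β * v := by
      have := Int.ceil_lt_add_one (β * v)
      rw [hd]; push_cast; linarith
    have hd2 : β * v ≤ d + 1 := by
      have := Int.le_ceil (β * v)
      rw [hd]; push_cast; linarith
    have hd0 : (0 : ℝ) ≤ d := by
      have : 0 < ⌈β * v⌉ := Int.ceil_pos.2 (by have := hvm.1; positivity)
      have : 0 ≤ d := by omega
      exact_mod_cast this
    -- Either the next digit agrees with that of `1`, and `k` grows by one, or it is strictly
    -- smaller; then the cylinder of order `n + 1` is full and the comparison restarts with `k = 0`.
    rcases eq_or_lt_of_le (Int.ceil_le_ceil (mul_le_mul_of_nonneg_left hvt (by positivity : 0 ≤ β)))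
      with heq | hlt
    · refine ⟨m, k + 1, by omega, a, ha, y, ⟨?_, hy.2⟩, hxy⟩
      have hT : (betaT β)^[k + 1] 1 = β * t - d := by
        rw [Function.iterate_succ_apply', ← ht, betaT, hd, heq]; push_cast; ring
      rw [hT]
      have e : (β * t - d) / β ^ (k + 1) = t / β ^ k - d / β ^ (k + 1) := by field_simp; ring
      rw [e]
      have : (d : ℝ) / β ^ (k + 1) < v / β ^ k := by
        rw [div_lt_div_iff₀ (by positivity) hpk, pow_succ]
        nlinarith
      linarith
    · have hdt : (d : ℝ) + 1 < β * t := by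
        have h3 := Int.ceil_lt_add_one (β * t)
        have h4 : (d : ℝ) + 2 ≤ ⌈β * t⌉ := by
          have : d + 2 ≤ ⌈β * t⌉ := by omega
          exact_mod_cast this
        linarith
      set b := 1 - t / β ^ k + d / β ^ (k + 1) with hb
      have hrel : ∀ z ∈ Set.Ioc (0 : ℝ) 1, b + z / β ^ (k + 1) ∈ Set.Ioc (1 - t / β ^ k) 1 := by
        intro z hz
        have hz0 := hz.1
        have e1 : b + z / β ^ (k + 1) = 1 - t / β ^ k + (d + z) / β ^ (k + 1) := by
          rw [hb]; ring
        have e2 : (d + z) / β ^ (k + 1) ≤ t / β ^ k := by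
          rw [div_le_div_iff₀ (by positivity) hpk, pow_succ]
          nlinarith [hz.2]
        have e3 : 0 < (d + z) / β ^ (k + 1) := by positivity
        rw [e1]
        constructor <;> linarith
      have hb0 : 0 ≤ b := by
        have : 0 ≤ (d : ℝ) / β ^ (k + 1) := by positivity
        linarith
      have e5 : ∀ z : ℝ, a + b / β ^ m + z / β ^ (n + 1) = a + (b + z / β ^ (k + 1)) / β ^ m := by
        intro z
        have : β ^ (n + 1) = β ^ (k + 1) * β ^ m := by rw [← pow_add]; congr 1; omega
        rw [this]
        field_simp
        ring
      refine ⟨n + 1, 0, rfl, a + b / β ^ m, ⟨?_, ?_⟩, β * v - d, ?_, ?_⟩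
      · have := ha.1
        positivity
      · intro z hz
        have hz0 := hz.1
        have hr := hrel z hz
        have hr' : b + z / β ^ (k + 1) ∈ Set.Ioc (0 : ℝ) 1 := ⟨by positivity, hr.2⟩
        have h6 := ha.2 _ hr'
        rw [e5]
        refine ⟨h6.1, ?_⟩
        have e6 : n + 1 = (k + 1) + m := by omega
        rw [e6, Function.iterate_add_apply, h6.2, Function.iterate_succ_apply', hk2 _ hr]
        have e7 : β * (t + β ^ k * (b + z / β ^ (k + 1) - 1)) = d + z := by
          rw [hb]; field_simp; ring
        rw [betaT_of_mem (d := d) (by rw [e7]; linarith) (by rw [e7]; linarith [hz.2]), e7]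
        ring
      · simp only [Function.iterate_zero, id, pow_zero, div_one, sub_self]
        constructor <;> linarith
      · rw [hxy, e5, hyv, hb]
        congr 2
        field_simp
        ring

/-- By the decomposition, a pair `(k, a)` confines `x` to an interval of length `β⁻ⁿ`, and `a` is a
full base of order `n` by monotonicity. These `(n + 1) * card` intervals cover `(0, 1]`, so their
total length is at least `1`. -/
theorem pow_le_card_fullBase {β : ℝ} (hβ : 1 < β) (n : ℕ) :
    β ^ n ≤ (n + 1) * (fullBase_finite hβ n).toFinset.card := by
  set F := (fullBase_finite hβ n).toFinset with hF
  have hpos : 0 < β ^ n := by positivity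
  let c : ℕ → ℝ → ℝ := fun k a => a + (1 - (betaT β)^[k] 1 / β ^ k) / β ^ (n - k)
  have hcover : Set.Ioc (0 : ℝ) 1 ⊆
      ⋃ p ∈ Finset.range (n + 1) ×ˢ F, Set.Ioc (c p.1 p.2) (c p.1 p.2 + (β ^ n)⁻¹) := by
    intro x hx
    obtain ⟨m, k, hmk, a, ha, y, hy, hxy⟩ := exists_fullBase_decomposition hβ hx n
    have hm : n - k = m := by omega
    have hpm : 0 < β ^ m := by positivity
    have ht := (betaT_iterate_mem β (x := 1) (by simp) k).2
    simp only [Set.mem_iUnion]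
    refine ⟨(k, a), ?_, ?_⟩
    · simp only [Finset.mem_product, Finset.mem_range, hF, Set.Finite.mem_toFinset]
      exact ⟨by omega, fullBase_mono hβ (by omega) ha⟩
    · simp only [c, hm, hxy]
      constructor
      · gcongr
        exact hy.1
      · have e : (β ^ n)⁻¹ = (1 / β ^ k) / β ^ m := by
          rw [← hmk, pow_add]; field_simp
        rw [e, add_assoc, ← add_div]
        gcongr
        have : (betaT β)^[k] 1 / β ^ k ≤ 1 / β ^ k := by gcongr
        linarith [hy.2]
  have h1 := (MeasureTheory.measure_mono (μ := MeasureTheory.volume) hcover).trans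
    (MeasureTheory.measure_biUnion_finset_le _ _)
  simp only [Real.volume_Ioc, add_sub_cancel_left, sub_zero, Finset.sum_const, nsmul_eq_mul,
    Finset.card_product, Finset.card_range] at h1
  rw [← ENNReal.ofReal_natCast, ← ENNReal.ofReal_mul (by positivity),
    ENNReal.ofReal_le_ofReal_iff (by positivity)] at h1
  push_cast at h1
  rwa [← div_eq_mul_inv, le_div_iff₀ hpos, one_mul] at h1

/-! ### Zero runs as small iterates -/

theorem digit_eq_zero_iff {β x : ℝ} (hβ : 1 < β) (hx : x ∈ Set.Ioc (0 : ℝ) 1) (n : ℕ) :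
    digit β x (n + 1) = 0 ↔ β * (betaT β)^[n] x ≤ 1 := by
  have hpos : 0 < β * (betaT β)^[n] x := by
    have := (betaT_iterate_mem β hx n).1
    positivity
  have hc : 0 < ⌈β * (betaT β)^[n] x⌉ := Int.ceil_pos.2 hpos
  rw [digit, if_neg hx.1.ne', Nat.add_sub_cancel]
  constructor
  · intro h
    have : ⌈β * (betaT β)^[n] x⌉ ≤ 1 := by omega
    simpa using Int.ceil_le.1 this
  · intro h
    have : ⌈β * (betaT β)^[n] x⌉ ≤ 1 := Int.ceil_le.2 (by simpa using h)
    omega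

theorem iterate_of_small {β x : ℝ} (hβ : 1 < β) (hx : x ∈ Set.Ioc (0 : ℝ) 1) (i k : ℕ)
    (h : (betaT β)^[i] x * β ^ k ≤ 1) : (betaT β)^[i + k] x = (betaT β)^[i] x * β ^ k := by
  have hT := (betaT_iterate_mem β hx i).1
  induction k with
  | zero => simp
  | succ k ih =>
    have h1 : (betaT β)^[i] x * β ^ k ≤ 1 := by
      refine le_trans ?_ h
      gcongr
      · exact hβ.le
      · omega
    have e : β * ((betaT β)^[i] x * β ^ k) = (betaT β)^[i] x * β ^ (k + 1) := by ring
    rw [← add_assoc, Function.iterate_succ_apply', ih h1, betaT_of_mem (d := 0)]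
    · rw [e]; simp
    · rw [e]; push_cast; positivity
    · rw [e]; simpa using h

/-- The digits at places `i + 1, …, i + j` vanish iff `T^i x ≤ β⁻ʲ`. -/
theorem digits_zero_iff {β x : ℝ} (hβ : 1 < β) (hx : x ∈ Set.Ioc (0 : ℝ) 1) (i j : ℕ) :
    (∀ k : ℕ, 1 ≤ k → k ≤ j → digit β x (i + k) = 0) ↔ (betaT β)^[i] x * β ^ j ≤ 1 := by
  constructor
  · intro h
    induction j with
    | zero => simpa using (betaT_iterate_mem β hx i).2
    | succ j ih =>
      have h1 := ih fun k hk hkj => h k hk (by omega)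
      have h2 := (digit_eq_zero_iff hβ hx (i + j)).1 (h (j + 1) (by omega) le_rfl)
      rw [iterate_of_small hβ hx i j h1] at h2
      rw [pow_succ]
      linarith
  · intro h k hk hkj
    obtain ⟨k, rfl⟩ : ∃ l, k = l + 1 := ⟨k - 1, by omega⟩
    have hT := (betaT_iterate_mem β hx i).1
    have hle : ∀ l ≤ j, (betaT β)^[i] x * β ^ l ≤ 1 := fun l hl => by
      refine le_trans ?_ h
      gcongr
      exact hβ.le
    have h2 := (digit_eq_zero_iff hβ hx (i + k)).2
    rw [iterate_of_small hβ hx i k (hle k (by omega))] at h2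
    refine h2 ?_
    have := hle (k + 1) hkj
    rw [pow_succ] at this
    linarith

theorem mem_zeroRuns_iff {β x : ℝ} (hβ : 1 < β) (hx : x ∈ Set.Ioc (0 : ℝ) 1) (n j : ℕ) :
    j ∈ zeroRuns β x n ↔ 1 ≤ j ∧ ∃ i : ℕ, i + j ≤ n ∧ (betaT β)^[i] x * β ^ j ≤ 1 := by
  simp only [zeroRuns, Set.mem_ofPred_eq, digits_zero_iff hβ hx]

theorem bddAbove_zeroRuns (β x : ℝ) (n : ℕ) : BddAbove (zeroRuns β x n) := by
  refine ⟨n, ?_⟩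
  rintro j ⟨_, i, hi, _⟩
  omega

theorem runLength_le_of_forall {β x : ℝ} {n m : ℕ} (h : ∀ j ∈ zeroRuns β x n, j ≤ m) :
    runLength β x n ≤ m := by
  rcases (zeroRuns β x n).eq_empty_or_nonempty with h0 | h0
  · simp [runLength, h0]
  · exact csSup_le h0 h

theorem runLength_le (β x : ℝ) (n : ℕ) : runLength β x n ≤ n :=
  runLength_le_of_forall fun _ ⟨_, _, hi, _⟩ => by omega

/-! ### Points built from full blocks -/

/-- The sum of the series with coefficients `B` in base `Q`. -/
def blockSum (Q : ℝ) (B : ℕ → ℝ) : ℝ := ∑' b, B b / Q ^ b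

theorem summable_blockSum {Q : ℝ} (hQ : 1 < Q) {B : ℕ → ℝ} {C : ℝ} (h0 : ∀ b, 0 ≤ B b)
    (h1 : ∀ b, B b ≤ C) : Summable fun b => B b / Q ^ b := by
  refine Summable.of_nonneg_of_le (fun b => ?_) (fun b => ?_)
    ((summable_geometric_of_lt_one (r := Q⁻¹) (by positivity)
      (inv_lt_one_of_one_lt₀ hQ)).mul_left C)
  · have := h0 b
    positivity
  · rw [inv_pow, ← div_eq_mul_inv]
    have := h1 b
    gcongr

theorem blockSum_eq {Q : ℝ} (hQ : 1 < Q) {B : ℕ → ℝ} {C : ℝ} (h0 : ∀ b, 0 ≤ B b)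
    (h1 : ∀ b, B b ≤ C) : blockSum Q B = B 0 + blockSum Q (fun b => B (b + 1)) / Q := by
  rw [blockSum, (summable_blockSum hQ h0 h1).tsum_eq_zero_add, blockSum, ← tsum_div_const]
  simp only [pow_zero, div_one, pow_succ, div_div]

/-- A sequence of left endpoints of full cylinders of order `N`, bounded away from `1 / β`, with
infinitely many nonzero terms. -/
structure IsBlockSeq (β : ℝ) (N : ℕ) (B : ℕ → ℝ) : Prop where
  mem : ∀ b, B b ∈ fullBase β N
  le : ∀ b, B b ≤ 1 / β - 1 / β ^ N
  inf : ∀ b, ∃ c ≥ b, B c ≠ 0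

namespace IsBlockSeq

variable {β : ℝ} {N : ℕ} {B B' : ℕ → ℝ}

theorem shift (h : IsBlockSeq β N B) (n : ℕ) : IsBlockSeq β N (fun b => B (b + n)) := by
  refine ⟨fun b => h.mem _, fun b => h.le _, fun b => ?_⟩
  obtain ⟨c, hc, hB⟩ := h.inf (b + n)
  exact ⟨c - n, by omega, by rwa [Nat.sub_add_cancel (by omega)]⟩

theorem nonneg (h : IsBlockSeq β N B) (b : ℕ) : 0 ≤ B b := (h.mem b).1

theorem summable (h : IsBlockSeq β N B) (hβ : 1 < β) (hN : N ≠ 0) :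
    Summable fun b => B b / (β ^ N) ^ b :=
  summable_blockSum (one_lt_pow₀ hβ hN) h.nonneg h.le

theorem blockSum_eq (h : IsBlockSeq β N B) (hβ : 1 < β) (hN : N ≠ 0) :
    blockSum (β ^ N) B = B 0 + blockSum (β ^ N) (fun b => B (b + 1)) / β ^ N :=
  BetaExpansion.blockSum_eq (one_lt_pow₀ hβ hN) h.nonneg h.le

/-- Positivity of every tail is why infinitely many nonzero blocks are required: cylinders are open
on the left. -/
theorem blockSum_pos (h : IsBlockSeq β N B) (hβ : 1 < β) (hN : N ≠ 0) :
    0 < blockSum (β ^ N) B := by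
  obtain ⟨c, _, hc⟩ := h.inf 0
  have hc' : 0 < B c := lt_of_le_of_ne (h.nonneg c) hc.symm
  refine (h.summable hβ hN).tsum_pos (fun b => ?_) c (by positivity)
  have := h.nonneg b
  positivity

theorem blockSum_le (h : IsBlockSeq β N B) (hβ : 1 < β) (hN : N ≠ 0) :
    blockSum (β ^ N) B ≤ 1 / β := by
  have hQ : 1 < β ^ N := one_lt_pow₀ hβ hN
  have hg := (hasSum_geometric_of_lt_one (r := (β ^ N)⁻¹) (by positivity)
      (inv_lt_one_of_one_lt₀ hQ)).mul_left (1 / β - 1 / β ^ N)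
  have h1 : blockSum (β ^ N) B ≤ (1 / β - 1 / β ^ N) * (1 - (β ^ N)⁻¹)⁻¹ := by
    rw [← hg.tsum_eq]
    refine Summable.tsum_le_tsum (fun b => ?_) (h.summable hβ hN) hg.summable
    rw [inv_pow, ← div_eq_mul_inv]
    have := h.le b
    gcongr
  refine h1.trans ?_
  have hq : 0 < 1 - (β ^ N)⁻¹ := by
    have := inv_lt_one_of_one_lt₀ hQ
    linarith
  rw [← div_eq_mul_inv, div_le_iff₀ hq]
  have h3 : 1 / β * (β ^ N)⁻¹ ≤ 1 * (β ^ N)⁻¹ := by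
    gcongr
    exact (div_le_one (by positivity)).2 hβ.le
  rw [mul_sub, one_div (β ^ N)]
  linarith

theorem blockSum_mem (h : IsBlockSeq β N B) (hβ : 1 < β) (hN : N ≠ 0) :
    blockSum (β ^ N) B ∈ Set.Ioc (0 : ℝ) 1 :=
  ⟨h.blockSum_pos hβ hN,
    (h.blockSum_le hβ hN).trans ((div_le_one (by positivity)).2 hβ.le)⟩

/-- The tail lies in `(0, 1]`, so fullness of the leading block lets `T_β^N` strip it off. -/
theorem iterate_blockSum (h : IsBlockSeq β N B) (hβ : 1 < β) (hN : N ≠ 0) (b : ℕ) :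
    (betaT β)^[N * b] (blockSum (β ^ N) B) = blockSum (β ^ N) (fun j => B (j + b)) := by
  induction b with
  | zero => simp
  | succ b ih =>
    have hb := h.shift b
    have e : (fun j => B (j + 1 + b)) = fun j => B (j + (b + 1)) := by
      ext j; congr 1; omega
    rw [mul_add, mul_one, add_comm, Function.iterate_add_apply, ih, hb.blockSum_eq hβ hN,
      ((hb.mem 0).2 _ ((hb.shift 1).blockSum_mem hβ hN)).2, e]

/-- The leading bases differ by at least `β⁻ᴺ`, while the lower tail recovers at most the fraction
`1/β` of that; hence the bound imposed on the letters. -/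
theorem blockSum_gap_of_lt (h : IsBlockSeq β N B) (h' : IsBlockSeq β N B') (hβ : 1 < β)
    (hN : N ≠ 0) (hlt : B 0 < B' 0) :
    (1 - 1 / β) / β ^ N ≤ blockSum (β ^ N) B' - blockSum (β ^ N) B := by
  have h1 := fullBase_separated hβ (h.mem 0) (h'.mem 0) hlt
  have h2 := (h.shift 1).blockSum_le hβ hN
  have h3 := (h'.shift 1).blockSum_pos hβ hN
  rw [h.blockSum_eq hβ hN, h'.blockSum_eq hβ hN]
  have h4 : blockSum (β ^ N) (fun b => B (b + 1)) / β ^ N ≤ 1 / β / β ^ N := by gcongr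
  have h5 : 0 < blockSum (β ^ N) (fun b => B' (b + 1)) / β ^ N := by positivity
  rw [sub_div, one_div (β ^ N)]
  linarith

theorem blockSum_gap (h : IsBlockSeq β N B) (h' : IsBlockSeq β N B') (hβ : 1 < β)
    (hN : N ≠ 0) {b : ℕ} (heq : ∀ c < b, B c = B' c) (hne : B b ≠ B' b) :
    (1 - 1 / β) / (β ^ N) ^ (b + 1) ≤ |blockSum (β ^ N) B - blockSum (β ^ N) B'| := by
  induction b generalizing B B' with
  | zero =>
    rw [zero_add, pow_one]
    rcases lt_or_gt_of_ne hne with hlt | hlt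
    · rw [abs_sub_comm]
      exact (blockSum_gap_of_lt h h' hβ hN hlt).trans (le_abs_self _)
    · exact (blockSum_gap_of_lt h' h hβ hN hlt).trans (le_abs_self _)
  | succ b ih =>
    have h1 := ih (h.shift 1) (h'.shift 1) (fun c hc => heq (c + 1) (by omega)) hne
    rw [h.blockSum_eq hβ hN, h'.blockSum_eq hβ hN, heq 0 (by omega), add_sub_add_left_eq_sub,
      ← sub_div, abs_div, abs_of_pos (show 0 < β ^ N by positivity), pow_succ, ← div_div]
    gcongr

/-- A vanishing stretch of `l` blocks gives a run of `N * l` zeros. -/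
theorem le_runLength (h : IsBlockSeq β N B) (hβ : 1 < β) (hN : N ≠ 0) {b l n : ℕ} (hl : l ≠ 0)
    (hn : N * (b + l) ≤ n) (hz : ∀ j < l, B (b + j) = 0) :
    N * l ≤ runLength β (blockSum (β ^ N) B) n := by
  refine le_csSup (bddAbove_zeroRuns _ _ _) ?_
  rw [mem_zeroRuns_iff hβ (h.blockSum_mem hβ hN)]
  refine ⟨Nat.mul_pos (Nat.pos_of_ne_zero hN) (Nat.pos_of_ne_zero hl), N * b,
    by rw [← mul_add]; exact hn, ?_⟩
  rw [h.iterate_blockSum hβ hN]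
  clear hl hn
  induction l generalizing b with
  | zero => simpa using ((h.shift b).blockSum_mem hβ hN).2
  | succ l ih =>
    have hpos : 0 < β ^ N := by positivity
    have h1 := ih (b := b + 1) fun j hj => by
      rw [add_right_comm]; exact hz (j + 1) (by omega)
    have e : (fun j => B (j + 1 + b)) = fun j => B (j + (b + 1)) := by
      ext j; congr 1; omega
    have h0 : B (0 + b) = 0 := by simpa using hz 0 (by omega)
    rw [(h.shift b).blockSum_eq hβ hN, h0, e, zero_add, mul_add, mul_one, pow_add]
    refine le_of_eq_of_le ?_ h1
    field_simp

/-- If all blocks in `[s, e)` are nonzero, the zero runs before place `N * e` are short. -/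
theorem runLength_le (h : IsBlockSeq β N B) (hβ : 1 < β) (hN : N ≠ 0) {s e : ℕ}
    (hz : ∀ b, s ≤ b → b < e → B b ≠ 0) :
    runLength β (blockSum (β ^ N) B) (N * e) ≤ N * s + 2 * N := by
  refine runLength_le_of_forall fun j hj => ?_
  obtain ⟨hj1, i, hi, hT⟩ := (mem_zeroRuns_iff hβ (h.blockSum_mem hβ hN) _ _).1 hj
  by_contra! hlt
  have hNpos := Nat.pos_of_ne_zero hN
  -- A block with index at least `s` that starts after place `i` and fits inside a run longer than
  -- `N * s + 2 * N`.
  set b := i / N + s + 1 with hb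
  have hdm := Nat.div_add_mod i N
  have hml := Nat.mod_lt i hNpos
  have hNb : N * b = N * (i / N) + N * s + N := by rw [hb]; ring
  have hle : N * b + N ≤ i + j := by omega
  have hbe : b < e := by
    have : N * b < N * e := by omega
    exact Nat.lt_of_mul_lt_mul_left this
  have hpos : 0 < B b := lt_of_le_of_ne (h.nonneg b) (hz b (Nat.le_succ_of_le (Nat.le_add_left _ _)) hbe).symm
  have hge := fullBase_separated hβ (zero_mem_fullBase hβ N) (h.mem b) hpos
  have hmem := h.blockSum_mem hβ hN
  have hTi := (betaT_iterate_mem β hmem i).1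
  obtain ⟨m, hm⟩ : ∃ m, N * b = i + m := ⟨N * b - i, by omega⟩
  have h1 : (betaT β)^[N * b] (blockSum (β ^ N) B) * β ^ N ≤ 1 := by
    have hmN : (betaT β)^[i] (blockSum (β ^ N) B) * β ^ (m + N) ≤ 1 := by
      refine le_trans ?_ hT
      gcongr
      · exact hβ.le
      · omega
    have hm' : (betaT β)^[i] (blockSum (β ^ N) B) * β ^ m ≤ 1 := by
      refine le_trans ?_ hmN
      gcongr
      · exact hβ.le
      · omega
    rw [hm, iterate_of_small hβ hmem i m hm', mul_assoc, ← pow_add]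
    exact hmN
  rw [h.iterate_blockSum hβ hN, (h.shift b).blockSum_eq hβ hN, zero_add] at *
  have h5 := ((h.shift b).shift 1).blockSum_pos hβ hN
  have hQ : 0 < β ^ N := by positivity
  rw [add_mul, div_mul_cancel₀ _ hQ.ne'] at h1
  have h6 : 1 ≤ B b * β ^ N := by
    have := mul_le_mul_of_nonneg_right hge hQ.le
    rwa [inv_mul_cancel₀ hQ.ne'] at this
  linarith

end IsBlockSeq

/-! ### Choice of letters and of zero positions -/

/-- The letters are the nonzero full bases of order `N - 1` with a zero digit prepended, which gives
the upper bound. The polynomial loss in the count is absorbed because `β^t < β`. -/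
theorem exists_letters {β t : ℝ} (hβ : 1 < β) (ht0 : 0 < t) (ht1 : t < 1) :
    ∃ N M : ℕ, N ≠ 0 ∧ 1 < M ∧ (β ^ N) ^ t ≤ (M : ℝ) ∧ ∃ a : Fin M → ℝ, Function.Injective a ∧
      ∀ i, a i ∈ fullBase β N ∧ a i ≤ 1 / β - 1 / β ^ N ∧ a i ≠ 0 := by
  have hβ0 : 0 < β := by linarith
  set γ := β ^ t with hγ
  have hγ1 : 1 < γ := Real.one_lt_rpow hβ ht0
  have hγβ : γ < β := by
    simpa using Real.rpow_lt_rpow_of_exponent_lt hβ ht1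
  have hlim := tendsto_self_mul_const_pow_of_lt_one (r := γ / β) (by positivity)
    ((div_lt_one hβ0).2 hγβ)
  have hev := (hlim.eventually (gt_mem_nhds (show 0 < 1 / (4 * β) by positivity))).and
    (eventually_ge_atTop 1)
  obtain ⟨N, hN, hN1⟩ := hev.exists
  obtain ⟨n, rfl⟩ : ∃ n, N = n + 1 := ⟨N - 1, by omega⟩
  set F := (fullBase_finite hβ n).toFinset with hF
  have hcard := pow_le_card_fullBase hβ n
  rw [← hF] at hcard
  have hγN : 1 ≤ γ ^ (n + 1) := one_le_pow₀ hγ1.le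
  -- The factor `4` leaves room to discard the base `0` and still have more than one letter.
  have hbig : 4 * γ ^ (n + 1) ≤ F.card := by
    have h1 : ((n : ℝ) + 1) * γ ^ (n + 1) * (4 * β) < β ^ (n + 1) := by
      rw [div_pow, lt_div_iff₀ (by positivity)] at hN
      push_cast at hN
      have e : ((n : ℝ) + 1) * (γ ^ (n + 1) / β ^ (n + 1)) * (4 * β) =
        ((n : ℝ) + 1) * γ ^ (n + 1) * (4 * β) / β ^ (n + 1) := by ring
      rwa [e, div_lt_one (by positivity)] at hN
    have h2 : (((n : ℝ) + 1) * β) * (4 * γ ^ (n + 1)) ≤ (((n : ℝ) + 1) * β) * F.card := by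
      have := mul_le_mul_of_nonneg_right hcard hβ0.le
      rw [← pow_succ] at this
      linarith
    exact le_of_mul_le_mul_left h2 (by positivity)
  set G := F.erase 0 with hG
  have h0F : (0 : ℝ) ∈ F := by simpa [hF] using zero_mem_fullBase hβ n
  have hGc : (G.card : ℝ) = F.card - 1 := by
    have := Finset.card_erase_add_one h0F
    rw [← hG] at this
    rw [← this]
    push_cast
    ring
  refine ⟨n + 1, G.card, by omega, ?_, ?_, fun i => (G.equivFin.symm i : ℝ) / β, ?_, ?_⟩
  · have : (1 : ℝ) < G.card := by linarith
    exact_mod_cast this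
  · have e : (β ^ (n + 1)) ^ t = γ ^ (n + 1) := by
      rw [hγ, Real.rpow_pow_comm hβ0.le]
    rw [e]
    linarith
  · intro i j hij
    have h : (G.equivFin.symm i : ℝ) = G.equivFin.symm j := by
      have := congrArg (· * β) hij
      simpa [hβ0.ne'] using this
    exact G.equivFin.symm.injective (Subtype.ext h)
  · intro i
    obtain ⟨h0, hmem⟩ := Finset.mem_erase.1 (G.equivFin.symm i).2
    have hmem' : (G.equivFin.symm i : ℝ) ∈ fullBase β n := by simpa [hF] using hmem
    refine ⟨div_mem_fullBase_succ hβ hmem', ?_, div_ne_zero h0 hβ0.ne'⟩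
    have h1 := (hmem'.2 1 (by simp)).1
    have e : 1 / β - 1 / β ^ (n + 1) = (1 - 1 / β ^ n) / β := by
      field_simp
      ring
    rw [e]
    refine div_le_div_of_nonneg_right ?_ hβ0.le
    linarith

theorem exists_sparse_positions {φ : ℕ → ℝ} (hφ_pos : ∀ n : ℕ, 1 ≤ n → 0 < φ n)
    (hφ_lim : Tendsto φ atTop atTop) (hfreq : ∀ C : ℝ, ∃ᶠ n : ℕ in atTop, C ≤ n / φ n)
    {N D : ℕ} (hN : N ≠ 0) (hD : D ≠ 0) :
    ∃ p : ℕ → ℕ, (∀ k, D ≤ p k) ∧ (∀ k, 2 * p k < p (k + 1)) ∧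
      (∀ k : ℕ, (k + 1 : ℝ) * ((N * (2 * p k) + 2 * N : ℕ) : ℝ) ≤ φ (N * p (k + 1))) ∧
      ∀ k : ℕ, ∃ n : ℕ, N * (2 * p k) ≤ n ∧ (k : ℝ) * φ n ≤ ((N * (p k / D) : ℕ) : ℝ) := by
  have hNpos := Nat.pos_of_ne_zero hN
  have hDpos := Nat.pos_of_ne_zero hD
  have step : ∀ k p : ℕ, ∃ p' : ℕ, D ≤ p' ∧ 2 * p < p' ∧
      (k : ℝ) * ((N * (2 * p) + 2 * N : ℕ) : ℝ) ≤ φ (N * p') ∧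
      ∃ n : ℕ, N * (2 * p') ≤ n ∧ (k : ℝ) * φ n ≤ ((N * (p' / D) : ℕ) : ℝ) := by
    intro k p
    obtain ⟨n₀, hn₀⟩ := eventually_atTop.1
      (hφ_lim.eventually_ge_atTop ((k : ℝ) * ((N * (2 * p) + 2 * N : ℕ) : ℝ)))
    -- The constant `8 * D` is the product of two rounding losses: `n < 4 * N * p'` and `p' ≤ 2 * D
    -- * (p' / D)`.
    obtain ⟨n, hn, hC⟩ := frequently_atTop.1 (hfreq (8 * D * k)) (2 * N * (2 * p + D + n₀ + 1))
    set p' := n / (2 * N) with hp'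
    have hge : 2 * p + D + n₀ + 1 ≤ p' := by
      rw [hp', Nat.le_div_iff_mul_le (by omega), mul_comm]
      exact hn
    refine ⟨p', by omega, by omega, hn₀ _ ?_, n, ?_, ?_⟩
    · calc n₀ ≤ 1 * p' := by omega
        _ ≤ N * p' := Nat.mul_le_mul_right _ hNpos
    · have := Nat.div_mul_le_self n (2 * N)
      rw [← hp'] at this
      calc N * (2 * p') = p' * (2 * N) := by ring
        _ ≤ n := this
    · have h1 : n < 4 * N * p' := by
        have := Nat.lt_mul_div_succ n (show 0 < 2 * N by omega)
        rw [← hp'] at this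
        have h3 : 2 * N * (p' + 1) ≤ 2 * N * (2 * p') := Nat.mul_le_mul_left _ (by omega)
        calc n < 2 * N * (2 * p') := this.trans_le h3
          _ = 4 * N * p' := by ring
      have h2 : p' ≤ 2 * D * (p' / D) := by
        have h4 := Nat.lt_mul_div_succ p' hDpos
        have h5 : 1 ≤ p' / D := (Nat.one_le_div_iff hDpos).2 (by omega)
        have h6 : D * (p' / D + 1) ≤ D * (2 * (p' / D)) := Nat.mul_le_mul_left _ (by omega)
        calc p' ≤ D * (2 * (p' / D)) := (h4.trans_le h6).le
          _ = 2 * D * (p' / D) := by ring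
      have h3 : n ≤ 8 * D * (N * (p' / D)) := by
        calc n ≤ 4 * N * p' := h1.le
          _ ≤ 4 * N * (2 * D * (p' / D)) := Nat.mul_le_mul_left _ h2
          _ = 8 * D * (N * (p' / D)) := by ring
      have h3' : (n : ℝ) ≤ 8 * D * ((N * (p' / D) : ℕ) : ℝ) := by exact_mod_cast h3
      have hn1 : 1 ≤ n := by
        have : 0 < 2 * N * (2 * p + D + n₀ + 1) := by positivity
        omega
      rw [le_div_iff₀ (hφ_pos n hn1)] at hC
      have hD' : (0 : ℝ) < 8 * D := by positivity
      refine le_of_mul_le_mul_left ?_ hD'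
      linarith
  choose f hf1 hf2 hf3 hf4 using step
  let p : ℕ → ℕ := fun k => Nat.rec (f 0 0) (fun k q => f (k + 1) q) k
  have hp : ∀ k, p (k + 1) = f (k + 1) (p k) := fun k => rfl
  have hp0 : p 0 = f 0 0 := rfl
  refine ⟨p, fun k => ?_, fun k => ?_, fun k => ?_, fun k => ?_⟩
  · cases k with
    | zero => exact hf1 _ _
    | succ k => exact hf1 _ _
  · exact hf2 _ _
  · have := hf3 (k + 1) (p k)
    push_cast at this ⊢
    exact this
  · cases k with
    | zero => exact hf4 _ _
    | succ k => exact hf4 _ _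

/-! ### Density of the forced zero blocks -/

/-- The union of the integer intervals `[p k, p k + p k / D)`. -/
def sparseSet (p : ℕ → ℕ) (D : ℕ) : Set ℕ := {b | ∃ k, p k ≤ b ∧ b < p k + p k / D}

section sparseSet

variable {p : ℕ → ℕ} {D : ℕ}

theorem strictMono_of_double (hp : ∀ k, 2 * p k < p (k + 1)) : StrictMono p :=
  strictMono_nat_of_lt_succ fun k => by have := hp k; omega

theorem notMem_sparseSet (hp : ∀ k, 2 * p k < p (k + 1)) {k b : ℕ} (h1 : 2 * p k ≤ b)
    (h2 : b < p (k + 1)) : b ∉ sparseSet p D := by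
  rintro ⟨j, hj1, hj2⟩
  have hm := (strictMono_of_double hp).monotone
  have hdiv := Nat.div_le_self (p j) D
  rcases Nat.lt_or_ge k j with h | h
  · have := hm (show k + 1 ≤ j from h)
    omega
  · have := hm h
    omega

theorem exists_notMem_sparseSet (hp : ∀ k, 2 * p k < p (k + 1)) (n : ℕ) :
    ∃ b ≥ n, b ∉ sparseSet p D :=
  ⟨2 * p n, by have := (strictMono_of_double hp).le_apply (x := n); omega,
    notMem_sparseSet hp le_rfl (hp n)⟩

theorem infinite_compl_sparseSet (hp : ∀ k, 2 * p k < p (k + 1)) :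
    (Set.ofPred fun b => b ∉ sparseSet p D).Infinite := by
  refine Set.infinite_of_forall_exists_gt fun n => ?_
  obtain ⟨b, hb, h⟩ := exists_notMem_sparseSet (D := D) hp (n + 1)
  exact ⟨b, h, hb⟩

open Classical in
-- The intervals starting before `b` have total length at most `(∑ p k) / D`, and doubling bounds
-- the sum by twice its last term, hence by `2 * b`.
theorem le_count_compl_sparseSet (hp : ∀ k, 2 * p k < p (k + 1)) (b : ℕ) :
    D * b ≤ D * Nat.count (fun b => b ∉ sparseSet p D) b + 2 * b := by
  have hmono := strictMono_of_double hp
  have hsum : ∀ K, ∑ k ∈ Finset.range (K + 1), p k ≤ 2 * p K := by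
    intro K
    induction K with
    | zero => simp; omega
    | succ K ih =>
      rw [Finset.sum_range_succ]
      have := hp K
      omega
  have hcount : D * ((Finset.range b).filter (· ∈ sparseSet p D)).card ≤ 2 * b := by
    by_cases hb : ∃ k, p k < b
    · have hbd : ∀ k, p k < b → k ≤ b := fun k hk => (hmono.le_apply.trans hk.le)
      set K := Nat.findGreatest (fun k => p k < b) b with hK
      obtain ⟨k₀, hk₀⟩ := hb
      have hKb : p K < b := Nat.findGreatest_spec (P := fun k => p k < b) (hbd k₀ hk₀) hk₀
      have hsub : (Finset.range b).filter (· ∈ sparseSet p D) ⊆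
          (Finset.range (K + 1)).biUnion fun k => Finset.Ico (p k) (p k + p k / D) := by
        intro c hc
        obtain ⟨hcb, k, hk1, hk2⟩ := Finset.mem_filter.1 hc
        rw [Finset.mem_range] at hcb
        have hkK : k ≤ K :=
          Nat.le_findGreatest (hbd k (hk1.trans_lt hcb)) (hk1.trans_lt hcb)
        exact Finset.mem_biUnion.2 ⟨k, Finset.mem_range.2 (by omega), Finset.mem_Ico.2 ⟨hk1, hk2⟩⟩
      have h1 := (Finset.card_le_card hsub).trans Finset.card_biUnion_le
      simp only [Nat.card_Ico, add_tsub_cancel_left] at h1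
      calc _ ≤ D * ∑ k ∈ Finset.range (K + 1), p k / D := Nat.mul_le_mul_left _ h1
        _ = ∑ k ∈ Finset.range (K + 1), D * (p k / D) := Finset.mul_sum _ _ _
        _ ≤ ∑ k ∈ Finset.range (K + 1), p k := Finset.sum_le_sum fun k _ => Nat.mul_div_le _ _
        _ ≤ 2 * p K := hsum K
        _ ≤ 2 * b := by omega
    · have : (Finset.range b).filter (· ∈ sparseSet p D) = ∅ := by
        rw [Finset.filter_eq_empty_iff]
        rintro c hc ⟨k, hk1, _⟩
        exact hb ⟨k, hk1.trans_lt (Finset.mem_range.1 hc)⟩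
      rw [this]
      simp
  have htot := Finset.card_filter_add_card_filter_not (s := Finset.range b) (· ∈ sparseSet p D)
  rw [Finset.card_range] at htot
  rw [Nat.count_eq_card_filter_range]
  have h2 : D * b = D * ((Finset.range b).filter (· ∈ sparseSet p D)).card +
      D * ((Finset.range b).filter (· ∉ sparseSet p D)).card := by rw [← mul_add, htot]
  omega

end sparseSet

/-! ### Hausdorff dimension and limit criteria -/

/-- The estimate shows that the digit value depends only on the point `X u`, so injectivity of `X`
is not needed. The resulting Hölder map sends the range onto `[0, 1]`, and a Hölder map of exponent
`s` multiplies dimension by at most `1 / s`. -/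
theorem le_dimH_range {M : ℕ} (hM : 1 < M) {X : (ℕ → Fin M) → ℝ} {C : ℝ} {s : NNReal}
    (hs : 0 < s) (hC : 0 ≤ C)
    (h : ∀ u v, |Real.ofDigits u - Real.ofDigits v| ≤ C * |X u - X v| ^ (s : ℝ)) :
    (s : ENNReal) ≤ dimH (Set.range X) := by
  have : Nonempty (ℕ → Fin M) := ⟨fun _ => ⟨0, by omega⟩⟩
  set f : ℝ → ℝ := fun x => Real.ofDigits (Function.invFun X x) with hf
  have hfX : ∀ u, f (X u) = Real.ofDigits u := by
    intro u
    have hX : X (Function.invFun X (X u)) = X u := Function.invFun_eq ⟨u, rfl⟩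
    have := h (Function.invFun X (X u)) u
    rw [hX, sub_self, abs_zero, Real.zero_rpow (by exact_mod_cast hs.ne'), mul_zero] at this
    exact sub_eq_zero.1 (abs_nonpos_iff.1 this)
  have hH : HolderOnWith C.toNNReal s f (Set.range X) := by
    rintro _ ⟨u, rfl⟩ _ ⟨v, rfl⟩
    have hCe : (C.toNNReal : ENNReal) = ENNReal.ofReal C := rfl
    rw [hfX, hfX, edist_dist, edist_dist, Real.dist_eq, Real.dist_eq, hCe,
      ENNReal.ofReal_rpow_of_nonneg (abs_nonneg _) s.coe_nonneg, ← ENNReal.ofReal_mul hC]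
    exact ENNReal.ofReal_le_ofReal (h u v)
  have h1 := hH.dimH_image_le hs
  have h2 : Set.Icc (0 : ℝ) 1 ⊆ f '' Set.range X := by
    intro y hy
    obtain ⟨u, -, hu⟩ := Real.ofDigits_SurjOn hM hy
    exact ⟨X u, ⟨u, rfl⟩, (hfX u).trans hu⟩
  have h3 : dimH (Set.Icc (0 : ℝ) 1) = 1 := by
    rw [Real.dimH_of_nonempty_interior (by simp)]
    simp
  have h4 := (h3.symm.le.trans (dimH_mono h2)).trans h1
  rwa [ENNReal.le_div_iff_mul_le (Or.inl (by exact_mod_cast hs.ne')) (Or.inl (by simp)),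
    one_mul] at h4

theorem frequently_le_of_limsup_eq_top {f : ℕ → ℝ}
    (h : limsup (fun n => (f n : EReal)) atTop = ⊤) (C : ℝ) : ∃ᶠ n in atTop, C ≤ f n := by
  have : (C : EReal) < limsup (fun n => (f n : EReal)) atTop := by
    rw [h]; exact EReal.coe_lt_top C
  exact (frequently_lt_of_lt_limsup (by isBoundedDefault) this).mono fun n hn =>
    (EReal.coe_lt_coe_iff.1 hn).le

theorem liminf_div_eq_zero {r φ : ℕ → ℝ} (hr : ∀ n, 0 ≤ r n) (hφ_pos : ∀ n : ℕ, 1 ≤ n → 0 < φ n)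
    (h : ∀ k : ℕ, ∃ n ≥ k, (k : ℝ) * r n ≤ φ n) :
    liminf (fun n : ℕ => ((r n / φ n : ℝ) : EReal)) atTop = 0 := by
  refine le_antisymm (EReal.le_of_forall_lt_iff_le.1 fun z hz => ?_) ?_
  · have hz0 : 0 < z := by exact_mod_cast hz
    refine liminf_le_of_frequently_le' (frequently_atTop.2 fun m => ?_)
    obtain ⟨k, hk⟩ := exists_nat_ge (1 / z)
    -- The index serves as a multiplier at least `k` and puts `n` past `m`; the `+ 1` avoids `φ 0`,
    -- whose sign is unknown.
    obtain ⟨n, hn, hrn⟩ := h (k + m + 1)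
    refine ⟨n, by omega, EReal.coe_le_coe_iff.2 ?_⟩
    rw [div_le_iff₀ (hφ_pos n (by omega))]
    rw [div_le_iff₀ hz0] at hk
    have h1 : (k : ℝ) * r n ≤ φ n := by
      refine le_trans ?_ hrn
      have := hr n
      gcongr
      omega
    have h2 := mul_le_mul_of_nonneg_left h1 hz0.le
    nlinarith [hr n]
  · refine le_liminf_of_le (by isBoundedDefault) ?_
    filter_upwards [eventually_ge_atTop 1] with n hn
    exact_mod_cast div_nonneg (hr n) (hφ_pos n hn).le

theorem limsup_div_eq_top {r φ : ℕ → ℝ} (hφ_pos : ∀ n : ℕ, 1 ≤ n → 0 < φ n)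
    (h : ∀ k : ℕ, ∃ n ≥ k, (k : ℝ) * φ n ≤ r n) :
    limsup (fun n : ℕ => ((r n / φ n : ℝ) : EReal)) atTop = ⊤ := by
  refine top_le_iff.1 (EReal.ge_of_forall_gt_iff_ge.1 fun z _ => ?_)
  refine le_limsup_of_frequently_le' (frequently_atTop.2 fun m => ?_)
  obtain ⟨k, hk⟩ := exists_nat_ge z
  obtain ⟨n, hn, hrn⟩ := h (k + m + 1)
  refine ⟨n, by omega, EReal.coe_le_coe_iff.2 ?_⟩
  have hφ := hφ_pos n (by omega)
  rw [le_div_iff₀ hφ]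
  refine le_trans ?_ hrn
  gcongr
  push_cast
  linarith [(Nat.cast_nonneg m : (0 : ℝ) ≤ m)]

/-! ### The Cantor-type family of points -/

open Classical in
/-- The sequence vanishing on `Z` and listing the letters `a (u 0), a (u 1), …` off `Z`. -/
def sparseBlocks {M : ℕ} (Z : Set ℕ) (a : Fin M → ℝ) (u : ℕ → Fin M) (b : ℕ) : ℝ :=
  if b ∈ Z then 0 else a (u (Nat.count (fun b => b ∉ Z) b))

theorem isBlockSeq_sparseBlocks {β : ℝ} (hβ : 1 < β) {N M : ℕ} {a : Fin M → ℝ}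
    (ha : ∀ i, a i ∈ fullBase β N ∧ a i ≤ 1 / β - 1 / β ^ N ∧ a i ≠ 0) {Z : Set ℕ}
    (hZ : ∀ n, ∃ b ≥ n, b ∉ Z) (u : ℕ → Fin M) : IsBlockSeq β N (sparseBlocks Z a u) := by
  refine ⟨fun b => ?_, fun b => ?_, fun b => ?_⟩
  · rw [sparseBlocks]
    split_ifs
    · exact zero_mem_fullBase hβ N
    · exact (ha _).1
  · rw [sparseBlocks]
    split_ifs
    -- Any letter is nonnegative and below the bound, so the bound itself is nonnegative.
    · exact (ha (u 0)).1.1.trans (ha (u 0)).2.1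
    · exact (ha _).2.1
  · obtain ⟨c, hc, h⟩ := hZ b
    exact ⟨c, hc, by rw [sparseBlocks, if_neg h]; exact (ha _).2.2⟩

open Classical in
-- If the letters first differ at index `i`, placed in block `b`, the points are at least about
-- `β^(-N b)` apart and the digit values at most `M^(-i)`. Sparsity gives `i ≥ (1 - 2/D) b`, so `M^i
-- ≥ β^(N t i) ≥ β^(N b s)`.
theorem ofDigits_holder {β t : ℝ} (hβ : 1 < β) {N M D : ℕ} (hN : N ≠ 0) (hD : D ≠ 0)
    {s : NNReal} (ht : 0 ≤ t) (hst : (s : ℝ) ≤ t - 2 / D) (ht1 : t ≤ 1) (hM : (β ^ N) ^ t ≤ (M : ℝ))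
    {a : Fin M → ℝ} (hinj : Function.Injective a)
    (ha : ∀ i, a i ∈ fullBase β N ∧ a i ≤ 1 / β - 1 / β ^ N ∧ a i ≠ 0)
    {p : ℕ → ℕ} (hp : ∀ k, 2 * p k < p (k + 1)) (u v : ℕ → Fin M) :
    |Real.ofDigits u - Real.ofDigits v| ≤ (β ^ N / (1 - 1 / β)) ^ (s : ℝ) *
      |blockSum (β ^ N) (sparseBlocks (sparseSet p D) a u) -
        blockSum (β ^ N) (sparseBlocks (sparseSet p D) a v)| ^ (s : ℝ) := by
  have hδ : 0 < 1 - 1 / β := by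
    have := (div_lt_one (by positivity : 0 < β)).2 hβ
    linarith
  have hQ : 1 < β ^ N := one_lt_pow₀ hβ hN
  rcases eq_or_ne u v with rfl | huv
  · rw [sub_self, abs_zero]
    positivity
  have hex : ∃ i, u i ≠ v i := Function.ne_iff.1 huv
  set i := Nat.find hex with hi
  have hine : u i ≠ v i := Nat.find_spec hex
  have hieq : ∀ j < i, u j = v j := fun j hj => not_not.1 (Nat.find_min hex hj)
  set Z := sparseSet p D with hZ
  have hinf : (Set.ofPred fun b => b ∉ Z).Infinite := infinite_compl_sparseSet hp
  set b := Nat.nth (fun b => b ∉ Z) i with hb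
  have hcb : Nat.count (fun b => b ∉ Z) b = i := Nat.count_nth_of_infinite hinf i
  have hbZ : b ∉ Z := Nat.nth_mem_of_infinite hinf i
  have hB : ∀ w, IsBlockSeq β N (sparseBlocks Z a w) :=
    isBlockSeq_sparseBlocks hβ ha (exists_notMem_sparseSet hp)
  have hgap := (hB u).blockSum_gap (hB v) hβ hN (b := b) (fun c hc => by
    rw [sparseBlocks, sparseBlocks]
    split_ifs with h
    · rfl
    · have : Nat.count (fun b => b ∉ Z) c < i := hcb ▸ Nat.count_strict_mono h hc
      rw [hieq _ this]) (by
    rw [sparseBlocks, sparseBlocks, if_neg hbZ, if_neg hbZ, hcb]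
    exact fun h => hine (hinj h))
  set Δ := |blockSum (β ^ N) (sparseBlocks Z a u) - blockSum (β ^ N) (sparseBlocks Z a v)|
  have h1 : ((β ^ N) ^ b)⁻¹ ≤ β ^ N / (1 - 1 / β) * Δ := by
    rw [div_mul_eq_mul_div, le_div_iff₀ hδ]
    have h2 := mul_le_mul_of_nonneg_left hgap (by positivity : 0 ≤ β ^ N)
    refine le_of_eq_of_le ?_ h2
    rw [pow_succ]
    field_simp
  refine (Real.abs_ofDigits_sub_ofDigits_le hieq).trans ?_
  rw [← Real.mul_rpow (by positivity) (by positivity)]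
  refine le_trans ?_ (Real.rpow_le_rpow (by positivity) h1 s.coe_nonneg)
  rw [Real.inv_rpow (by positivity)]
  refine inv_anti₀ (by positivity) ?_
  have hcount := le_count_compl_sparseSet (D := D) hp b
  rw [← hZ, hcb] at hcount
  have hcount' : (D : ℝ) * b ≤ D * i + 2 * b := by exact_mod_cast hcount
  have hDpos : (0 : ℝ) < D := by positivity
  have hsi : (b : ℝ) * s ≤ t * i := by
    have h3 : (b : ℝ) - 2 / D * b ≤ i := by
      have : (b : ℝ) ≤ i + 2 / D * b := by
        refine le_of_mul_le_mul_left ?_ hDpos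
        refine hcount'.trans_eq ?_
        field_simp
      linarith
    have h4 := mul_le_mul_of_nonneg_left h3 ht
    have h5 := mul_le_mul_of_nonneg_left hst (Nat.cast_nonneg b : (0 : ℝ) ≤ b)
    have h6 : t * (2 / D * b) ≤ 1 * (2 / D * b) := by gcongr
    linarith
  calc ((β ^ N) ^ b) ^ (s : ℝ) = (β ^ N) ^ ((b : ℝ) * s) := by
        rw [Real.rpow_mul (by positivity), Real.rpow_natCast]
    _ ≤ (β ^ N) ^ (t * i) := Real.rpow_le_rpow_of_exponent_le hQ.le hsi
    _ = ((β ^ N) ^ t) ^ i := by rw [Real.rpow_mul (by positivity), Real.rpow_natCast]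
    _ ≤ (M : ℝ) ^ i := by gcongr

theorem blockSum_mem_exceptionalSet {β : ℝ} (hβ : 1 < β) {φ : ℕ → ℝ}
    (hφ_pos : ∀ n : ℕ, 1 ≤ n → 0 < φ n) {N M D : ℕ} (hN : N ≠ 0) (hD : D ≠ 0) {a : Fin M → ℝ}
    (ha : ∀ i, a i ∈ fullBase β N ∧ a i ≤ 1 / β - 1 / β ^ N ∧ a i ≠ 0)
    {p : ℕ → ℕ} (hpD : ∀ k, D ≤ p k) (hp : ∀ k, 2 * p k < p (k + 1))
    (hlow : ∀ k : ℕ, (k + 1 : ℝ) * ((N * (2 * p k) + 2 * N : ℕ) : ℝ) ≤ φ (N * p (k + 1)))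
    (hhigh : ∀ k : ℕ, ∃ n : ℕ, N * (2 * p k) ≤ n ∧ (k : ℝ) * φ n ≤ ((N * (p k / D) : ℕ) : ℝ))
    (u : ℕ → Fin M) :
    blockSum (β ^ N) (sparseBlocks (sparseSet p D) a u) ∈ exceptionalSet β φ := by
  have hB : IsBlockSeq β N (sparseBlocks (sparseSet p D) a u) :=
    isBlockSeq_sparseBlocks hβ ha (exists_notMem_sparseSet hp) u
  have hNpos := Nat.pos_of_ne_zero hN
  have hid : ∀ k, k ≤ p k := fun k => (strictMono_of_double hp).le_apply
  refine ⟨Set.Ioc_subset_Icc_self (hB.blockSum_mem hβ hN), ?_, ?_⟩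
  · refine liminf_div_eq_zero (r := fun n => (runLength β _ n : ℝ))
      (fun n => Nat.cast_nonneg _) hφ_pos fun k => ?_
    refine ⟨N * p (k + 1), ?_, ?_⟩
    · calc k ≤ 1 * p (k + 1) := by have := hid (k + 1); omega
        _ ≤ N * p (k + 1) := Nat.mul_le_mul_right _ hNpos
    · refine le_trans ?_ (hlow k)
      have := hB.runLength_le hβ hN (s := 2 * p k) (e := p (k + 1)) fun b h1 h2 => by
        rw [sparseBlocks, if_neg (notMem_sparseSet hp h1 h2)]
        exact (ha _).2.2
      gcongr
      linarith
  · refine limsup_div_eq_top (r := fun n => (runLength β _ n : ℝ)) hφ_pos fun k => ?_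
    obtain ⟨n, hn, hkn⟩ := hhigh k
    refine ⟨n, ?_, hkn.trans ?_⟩
    · calc k ≤ 1 * (2 * p k) := by have := hid k; omega
        _ ≤ N * (2 * p k) := Nat.mul_le_mul_right _ hNpos
        _ ≤ n := hn
    · have hdiv := Nat.div_le_self (p k) D
      have h1 := hB.le_runLength hβ hN (b := p k) (l := p k / D) (n := n)
        (Nat.div_pos (hpD k) (Nat.pos_of_ne_zero hD)).ne'
        ((Nat.mul_le_mul_left _ (by omega)).trans hn) fun j hj => by
          rw [sparseBlocks, if_pos ⟨k, by omega, by omega⟩]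
      exact_mod_cast h1

/-! ### The two cases of the theorem -/

theorem exceptionalSet_eq_empty {β : ℝ} {φ : ℕ → ℝ} (hφ_pos : ∀ n : ℕ, 1 ≤ n → 0 < φ n)
    (h : limsup (fun n : ℕ => (((n : ℝ) / φ n : ℝ) : EReal)) atTop < ⊤) :
    exceptionalSet β φ = ∅ := by
  refine Set.eq_empty_of_forall_notMem fun x hx => ?_
  have h1 := hx.2.2
  refine (h.trans_le (h1.symm.le.trans (limsup_le_limsup ?_))).false
  filter_upwards [eventually_ge_atTop 1] with n hn
  refine EReal.coe_le_coe_iff.2 ?_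
  have := hφ_pos n hn
  gcongr
  exact runLength_le β x n

theorem le_dimH_exceptionalSet {β : ℝ} (hβ : 1 < β) {φ : ℕ → ℝ}
    (hφ_pos : ∀ n : ℕ, 1 ≤ n → 0 < φ n) (hφ_lim : Tendsto φ atTop atTop)
    (h : limsup (fun n : ℕ => (((n : ℝ) / φ n : ℝ) : EReal)) atTop = ⊤) {s : NNReal} (hs0 : 0 < s)
    (hs : s < 1) : (s : ENNReal) ≤ dimH (exceptionalSet β φ) := by
  have hs1 : (s : ℝ) < 1 := by exact_mod_cast hs
  have hs0' : (0 : ℝ) < s := by exact_mod_cast hs0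
  -- The gap `1 - s` is split equally between the loss in the number of letters and the loss `2 / D`
  -- from the forced zeros.
  set t : ℝ := (1 + s) / 2 with ht
  obtain ⟨D, hD⟩ := exists_nat_ge (4 / (1 - (s : ℝ)))
  have h1s : 0 < 1 - (s : ℝ) := by linarith
  have hDpos : (0 : ℝ) < D := lt_of_lt_of_le (by positivity) hD
  have hD0 : D ≠ 0 := by
    rintro rfl
    simp at hDpos
  have hst : (s : ℝ) ≤ t - 2 / D := by
    have : 2 / (D : ℝ) ≤ (1 - s) / 2 := by
      rw [div_le_iff₀ h1s] at hD
      rw [div_le_iff₀ hDpos]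
      linarith
    rw [ht]
    linarith
  obtain ⟨N, M, hN, hM1, hM, a, hinj, ha⟩ :=
    exists_letters hβ (t := t) (by positivity) (by rw [ht]; linarith)
  obtain ⟨p, hpD, hp, hlow, hhigh⟩ := exists_sparse_positions hφ_pos hφ_lim
    (frequently_le_of_limsup_eq_top h) hN hD0
  have hδ : 0 < 1 - 1 / β := by
    have := (div_lt_one (by positivity : 0 < β)).2 hβ
    linarith
  refine (le_dimH_range hM1 hs0 (by positivity)
    (ofDigits_holder hβ hN hD0 (by positivity) hst (by rw [ht]; linarith) hM hinj ha hp)).trans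
    (dimH_mono ?_)
  rintro _ ⟨u, rfl⟩
  exact blockSum_mem_exceptionalSet hβ hφ_pos hN hD0 ha hpD hp hlow hhigh u

end BetaExpansion

end

theorem theorem1 (β : ℝ) (hβ : 1 < β) (φ : ℕ → ℝ) (hφ_pos : ∀ n : ℕ, 1 ≤ n → 0 < φ n)
    (hφ_lim : Filter.Tendsto φ Filter.atTop Filter.atTop) :
    (Filter.limsup (fun n : ℕ => (((n : ℝ) / φ n : ℝ) : EReal)) Filter.atTop < ⊤ →
      BetaExpansion.exceptionalSet β φ = ∅) ∧
    (Filter.limsup (fun n : ℕ => (((n : ℝ) / φ n : ℝ) : EReal)) Filter.atTop = ⊤ →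
      dimH (BetaExpansion.exceptionalSet β φ) = 1) := by
  refine ⟨BetaExpansion.exceptionalSet_eq_empty hφ_pos, fun h => le_antisymm ?_ ?_⟩
  · exact (dimH_mono (Set.subset_univ _)).trans Real.dimH_univ.le
  · refine ENNReal.le_of_forall_nnreal_lt fun s hs => ?_
    rcases eq_or_ne s 0 with rfl | h0
    · simp
    · exact BetaExpansion.le_dimH_exceptionalSet hβ hφ_pos hφ_lim h (pos_iff_ne_zero.2 h0)
        (by exact_mod_cast hs)
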